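/- Let $\{a_n\}_{n\in\mathbb{Z}}$ be an even sequence of positive real numbers that is convex on the non-negative integers, i.e. $a_{-n}=a_n>0$ for all $n\in\mathbb{Z}$ and $a_n+a_{n+2}-2a_{n+1}\ge 0$ for all $n\ge 0$. Suppose that $a_n\log n=O(1)$ but $a_n\log n\neq o(1)$ as $n\to\infty$. On $\mathbb{T}=\mathbb{R}/2\pi\mathbb{Z}$, with normalized Haar measure $dt$, let $$f(t)=\sum_{j=0}^{\infty}(j+1)\,(a_j+a_{j+2}-2a_{j+1})\,F_j(t),$$ where $F_j(t)=\frac{1}{j+1}\sum_{n=0}^{j}\sum_{|k|\le n}e^{ikt}$ is the $j$-th Fejér kernel, and let $S_N(f,t)=\sum_{|n|\le N}\hat f(n)e^{int}$ be the $N$-th partial sum of the Fourier series of $f$. Then the series defining $f$ converges absolutely for every $t\ne 0$ in $\mathbb{T}$, $f\in L^1(\mathbb{T})$, and there exists a measurable set $E\subset\mathbb{T}$ for which $$\lim_{N\to\infty}\int_E|f(t)-S_N(f,t)|\,dt$$ does not exist. (The value assigned to $f$ at $t=0$ is immaterial.) -/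

import Mathlib

open MeasureTheory Filter Topology Asymptotics

noncomputable section

/-- The torus `ℝ / 2πℤ`. Its normalized Haar measure is `AddCircle.haarAddCircle`, and
`fourier n` is the character `t ↦ e^{int}` on it. -/
abbrev Torus : Type := AddCircle (2 * Real.pi)

instance Torus.fact_two_pi_pos : Fact (0 < 2 * Real.pi) := ⟨Real.two_pi_pos⟩

/-- The Dirichlet kernel `D_N(t) = ∑_{|k| ≤ N} e^{ikt}`. -/
def dirichletKernel (N : ℕ) (t : Torus) : ℂ :=
  ∑ k ∈ Finset.Icc (-(N : ℤ)) (N : ℤ), fourier k t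

/-- The Fejér kernel `F_j(t) = (D_0(t) + ⋯ + D_j(t)) / (j + 1)`. -/
def fejerKernel (j : ℕ) (t : Torus) : ℂ :=
  ((j : ℂ) + 1)⁻¹ * ∑ n ∈ Finset.range (j + 1), dirichletKernel n t

/-- The `j`-th term `(j + 1) (a_j + a_{j+2} - 2 a_{j+1}) F_j(t)`. -/
def fejerTerm (a : ℤ → ℝ) (j : ℕ) (t : Torus) : ℂ :=
  (((j + 1 : ℝ) * (a j + a (j + 2) - 2 * a (j + 1)) : ℝ) : ℂ) * fejerKernel j t

/-- The function `f(t) = ∑_{j ≥ 0} (j + 1) (a_j + a_{j+2} - 2 a_{j+1}) F_j(t)`. At a point where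
the series diverges (under the hypotheses of the theorem, at most the point `t = 0`) the value
is `0`. -/
def fejerSum (a : ℤ → ℝ) (t : Torus) : ℂ :=
  ∑' j : ℕ, fejerTerm a j t

/-- The `N`-th symmetric partial sum `S_N(f, t) = ∑_{|n| ≤ N} f̂(n) e^{int}` of the Fourier
series of `f`. -/
def fourierPartialSum (f : Torus → ℂ) (N : ℕ) (t : Torus) : ℂ :=
  ∑ n ∈ Finset.Icc (-(N : ℤ)) (N : ℤ), fourierCoeff f n * fourier n t

end

/-! Two summations by parts (`sum_fejerTerm_add`) write `∑_{|k| ≤ N} a_k e^{ikt}` as a partial sum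
of the Fejér series, plus `(a_N - a_{N+1}) (D_0 + ⋯ + D_{N-1})`, plus `a_N D_N`. The Fejér series
converges in `L¹`. The middle term has norm `N (a_N - a_{N+1})`, which tends to `0` by convexity.
Hence `f̂(n) = a_n`, and `f - S_N` equals `-a_N D_N` up to an `L¹`-null error, so over every `E` the
integrals of `|f - S_N|` and `a_N |D_N|` differ by `o(1)`.

Since `‖D_N‖₁ ≥ log N / 2π`, the total mass of `a_N |D_N|` stays above a positive constant
infinitely often. Away from `t = 0` the kernels `D_N` are bounded uniformly in `N` and `a_N → 0`, so
this mass slides towards `0`. The gliding hump `exists_not_tendsto_setIntegral` then builds `E` from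
alternate annuli around `0`. The bound `a_n log n = O(1)` enters only through `a_n → 0`. -/

/-! ### Gliding hump. -/

/-- A gliding hump argument: if the integrals of `g N` stay large infinitely often while the mass
of `g N` moves to the small values of `u`, then the integrals over a suitable set diverge. -/
theorem exists_not_tendsto_setIntegral {X : Type*} [MeasurableSpace X] {μ : Measure X}
    {u : X → ℝ} (hu : Measurable u) {g : ℕ → X → ℝ} (hg : ∀ N x, 0 ≤ g N x)
    (hint : ∀ N, Integrable (g N) μ) {c : ℝ} (hc : 0 < c)
    (hlarge : ∃ᶠ N in atTop, c ≤ ∫ x, g N x ∂μ)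
    (haway : ∀ δ > 0, Tendsto (fun N => ∫ x in {x | δ ≤ u x}, g N x ∂μ) atTop (𝓝 0))
    (hnear : ∀ N, Tendsto (fun δ => ∫ x in {x | u x < δ}, g N x ∂μ) (𝓝[>] 0) (𝓝 0)) :
    ∃ E : Set X, MeasurableSet E ∧
      ¬ ∃ L : ℝ, Tendsto (fun N => ∫ x in E, g N x ∂μ) atTop (𝓝 L) := by
  -- Losing `c / 8` on each side of an annulus leaves at least `3c/4` inside and at most `c/4`
  -- outside; any fraction below `c / 4` would separate the two.
  have hc8 : 0 < c / 8 := by positivity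
  have step : ∀ (m : ℕ) (δ : {δ : ℝ // 0 < δ}), ∃ (N : ℕ) (δ' : {δ : ℝ // 0 < δ}), m ≤ N ∧
      δ'.1 < δ.1 ∧ c ≤ ∫ x, g N x ∂μ ∧ ∫ x in {x | δ.1 ≤ u x}, g N x ∂μ < c / 8 ∧
      ∫ x in {x | u x < δ'.1}, g N x ∂μ < c / 8 := by
    intro m δ
    obtain ⟨N, h1, h2, h3⟩ := (hlarge.and_eventually
      (((haway δ.1 δ.2).eventually (gt_mem_nhds hc8)).and (eventually_ge_atTop m))).exists
    obtain ⟨δ', h4, h5⟩ := (((hnear N).eventually (gt_mem_nhds hc8)).and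
      (Ioo_mem_nhdsGT δ.2)).exists
    exact ⟨N, ⟨δ', h5.1⟩, h3, h5.2, h1, h2, h4⟩
  choose n d hn hd hbig hout hin using step
  let δ : ℕ → {δ : ℝ // 0 < δ} := fun k => Nat.rec ⟨1, one_pos⟩ (fun k r => d k r) k
  let N : ℕ → ℕ := fun k => n k (δ k)
  have hδ : ∀ k, (δ (k + 1)).1 < (δ k).1 := fun k => hd k (δ k)
  have hanti : Antitone fun k => (δ k).1 := antitone_nat_of_succ_le fun k => (hδ k).le
  have hN : Tendsto N atTop atTop := tendsto_atTop_mono (fun k => hn k (δ k)) tendsto_id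
  have hNbig : ∀ k, c ≤ ∫ x, g (N k) x ∂μ := fun k => hbig k (δ k)
  have hNout : ∀ k, ∫ x in {x | (δ k).1 ≤ u x}, g (N k) x ∂μ < c / 8 := fun k => hout k (δ k)
  have hNin : ∀ k, ∫ x in {x | u x < (δ (k + 1)).1}, g (N k) x ∂μ < c / 8 := fun k => hin k (δ k)
  have hle : ∀ r, MeasurableSet {x | r ≤ u x} := fun r => measurableSet_le measurable_const hu
  have hlt : ∀ r, MeasurableSet {x | u x < r} := fun r => measurableSet_lt hu measurable_const
  -- Disjoint annuli, with `B k` carrying all but `c / 4` of the mass of `g (N k)`. The set `E`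
  -- keeps only those of even index.
  let B : ℕ → Set X := fun k => {x | (δ (k + 1)).1 ≤ u x} ∩ {x | u x < (δ k).1}
  have hB : ∀ k, MeasurableSet (B k) := fun k => (hle _).inter (hlt _)
  let E : Set X := ⋃ i, B (2 * i)
  have hE : MeasurableSet E := MeasurableSet.iUnion fun i => hB _
  have mono : ∀ M (s t : Set X), s ⊆ t → ∫ x in s, g M x ∂μ ≤ ∫ x in t, g M x ∂μ := fun M s t h =>
    setIntegral_mono_set (hint M).integrableOn (ae_of_all _ (hg M)) h.eventuallyLE
  have union : ∀ M (s t : Set X), MeasurableSet t →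
      ∫ x in s ∪ t, g M x ∂μ ≤ ∫ x in s, g M x ∂μ + ∫ x in t, g M x ∂μ := by
    intro M s t ht
    rw [← Set.sdiff_union_self, setIntegral_union Set.disjoint_sdiff_left ht
      (hint M).integrableOn (hint M).integrableOn]
    exact add_le_add_left (mono M _ _ Set.sdiff_subset) _
  have heven : ∀ i, 3 * c / 4 ≤ ∫ x in E, g (N (2 * i)) x ∂μ := by
    intro i
    have hcover : (Set.univ : Set X) ⊆
        (E ∪ {x | (δ (2 * i)).1 ≤ u x}) ∪ {x | u x < (δ (2 * i + 1)).1} := by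
      intro x _
      by_cases h1 : (δ (2 * i)).1 ≤ u x
      · exact Or.inl (Or.inr h1)
      · by_cases h2 : u x < (δ (2 * i + 1)).1
        · exact Or.inr h2
        · exact Or.inl (Or.inl (Set.mem_iUnion.2 ⟨i, not_lt.1 h2, not_le.1 h1⟩))
    have h := mono (N (2 * i)) _ _ hcover
    rw [setIntegral_univ] at h
    have h1 := union (N (2 * i)) (E ∪ {x | (δ (2 * i)).1 ≤ u x}) _ (hlt (δ (2 * i + 1)).1)
    have h2 := union (N (2 * i)) E _ (hle (δ (2 * i)).1)
    linarith [hNbig (2 * i), hNout (2 * i), hNin (2 * i)]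
  have hodd : ∀ i, ∫ x in E, g (N (2 * i + 1)) x ∂μ ≤ c / 4 := by
    intro i
    -- `E` misses the odd annulus `B (2 * i + 1)`, where `g (N (2 * i + 1))` is concentrated.
    have hsub : E ⊆ {x | (δ (2 * i + 1)).1 ≤ u x} ∪ {x | u x < (δ (2 * i + 1 + 1)).1} := by
      intro x hx
      obtain ⟨j, hj1, hj2⟩ := Set.mem_iUnion.1 hx
      rcases le_or_gt j i with hji | hji
      · exact Or.inl (le_trans (hanti (by omega : 2 * j + 1 ≤ 2 * i + 1)) hj1)
      · exact Or.inr (lt_of_lt_of_le hj2 (hanti (by omega : 2 * i + 1 + 1 ≤ 2 * j)))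
    have h := mono (N (2 * i + 1)) _ _ hsub
    have h1 := union (N (2 * i + 1)) {x | (δ (2 * i + 1)).1 ≤ u x} _ (hlt (δ (2 * i + 1 + 1)).1)
    linarith [hNout (2 * i + 1), hNin (2 * i + 1)]
  refine ⟨E, hE, ?_⟩
  rintro ⟨L, hL⟩
  have t1 : Tendsto (fun i : ℕ => 2 * i) atTop atTop :=
    tendsto_atTop_mono (fun i => by simp only [id]; omega) tendsto_id
  have t2 : Tendsto (fun i : ℕ => 2 * i + 1) atTop atTop :=
    tendsto_atTop_mono (fun i => by simp only [id]; omega) tendsto_id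
  have l1 : 3 * c / 4 ≤ L := ge_of_tendsto' (hL.comp (hN.comp t1)) heven
  have l2 : L ≤ c / 4 := le_of_tendsto' (hL.comp (hN.comp t2)) hodd
  linarith
-- Dirichlet kernels, their sums, and Fourier coefficients.
open AddCircle (haarAddCircle)

theorem sum_Icc_neg_eq_sum_range {M : Type*} [AddCommMonoid M] (F : ℤ → M) (N : ℕ) :
    ∑ k ∈ Finset.Icc (-(N : ℤ)) N, F k = ∑ m ∈ Finset.range (2 * N + 1), F ((m : ℤ) - N) := by
  symm
  refine Finset.sum_bij (fun m _ => (m : ℤ) - N) ?_ ?_ ?_ ?_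
  · intro m hm; simp only [Finset.mem_range, Finset.mem_Icc] at *; omega
  · intro m _ m' _ h; simpa using h
  · intro k hk
    simp only [Finset.mem_Icc] at hk
    exact ⟨(k + N).toNat, by simp only [Finset.mem_range]; omega, by omega⟩
  · intro m _; rfl

theorem fourier_natCast (m : ℕ) (t : Torus) :
    (fourier (m : ℤ) t : ℂ) = (fourier 1 t : ℂ) ^ m := by
  induction m with
  | zero => simp
  | succ m ih => rw [Nat.cast_succ, fourier_add, ih, pow_succ]

theorem norm_fourier_apply (n : ℤ) (t : Torus) : ‖(fourier n t : ℂ)‖ = 1 :=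
  Circle.norm_coe _

theorem fourier_sub_eq (m n : ℤ) (t : Torus) :
    (fourier (m - n) t : ℂ) = fourier m t * fourier (-n) t := by
  rw [sub_eq_add_neg, fourier_add]

/-- The distance of `e^{it}` from `1`. -/
noncomputable def chord (t : Torus) : ℝ := ‖1 - (fourier 1 t : ℂ)‖

theorem continuous_chord : Continuous chord := by
  unfold chord; fun_prop

theorem chord_eq_zero_iff {t : Torus} : chord t = 0 ↔ t = 0 := by
  unfold chord
  rw [norm_eq_zero, sub_eq_zero, fourier_one]
  constructor
  · intro h
    apply AddCircle.injective_toCircle (T := 2 * Real.pi) (by positivity)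
    rw [AddCircle.toCircle_zero]
    exact Subtype.ext h.symm
  · rintro rfl; simp

theorem chord_pos {t : Torus} (ht : t ≠ 0) : 0 < chord t :=
  lt_of_le_of_ne (norm_nonneg _) fun h => ht (chord_eq_zero_iff.1 h.symm)

theorem dirichletKernel_zero (t : Torus) : dirichletKernel 0 t = 1 := by
  simp [dirichletKernel]

theorem dirichletKernel_eq (N : ℕ) (t : Torus) :
    dirichletKernel N t =
      (∑ m ∈ Finset.range (2 * N + 1), (fourier 1 t : ℂ) ^ m) * fourier (-(N : ℤ)) t := by
  rw [dirichletKernel, sum_Icc_neg_eq_sum_range, Finset.sum_mul]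
  refine Finset.sum_congr rfl fun m _ => ?_
  rw [fourier_sub_eq, fourier_natCast]

theorem norm_geom_sum_mul_chord_le (n : ℕ) (t : Torus) :
    ‖∑ m ∈ Finset.range n, (fourier 1 t : ℂ) ^ m‖ * chord t ≤ 2 := by
  rw [chord, ← norm_mul, geom_sum_mul_neg]
  refine (norm_sub_le _ _).trans ?_
  rw [norm_one, norm_pow, norm_fourier_apply]
  norm_num

theorem norm_dirichletKernel_mul_chord_le (N : ℕ) (t : Torus) :
    ‖dirichletKernel N t‖ * chord t ≤ 2 := by
  rw [dirichletKernel_eq, norm_mul, norm_fourier_apply, mul_one]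
  exact norm_geom_sum_mul_chord_le _ t

theorem sum_Icc_neg_succ {M : Type*} [AddCommMonoid M] (F : ℤ → M) (n : ℕ) :
    ∑ k ∈ Finset.Icc (-((n + 1 : ℕ) : ℤ)) ((n + 1 : ℕ) : ℤ), F k =
      ∑ k ∈ Finset.Icc (-(n : ℤ)) n, F k + F (n + 1) + F (-(n + 1 : ℤ)) := by
  have : Finset.Icc (-((n + 1 : ℕ) : ℤ)) ((n + 1 : ℕ) : ℤ) =
      insert (-(n + 1 : ℤ)) (insert (n + 1 : ℤ) (Finset.Icc (-(n : ℤ)) n)) := by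
    ext k; simp only [Finset.mem_Icc, Finset.mem_insert]; omega
  rw [this, Finset.sum_insert, Finset.sum_insert, add_comm, add_comm (F (n + 1))]
  · simp
  · simp only [Finset.mem_Icc, Finset.mem_insert]; omega

/-- The sum `D_0 + ⋯ + D_{n-1}` of Dirichlet kernels. -/
noncomputable def dirichletSum (n : ℕ) (t : Torus) : ℂ :=
  ∑ k ∈ Finset.range n, dirichletKernel k t

theorem dirichletKernel_eq_add_conj (n : ℕ) (t : Torus) :
    dirichletKernel n t =
      1 + ∑ m ∈ Finset.range n, ((fourier 1 t : ℂ) ^ (m + 1)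
        + starRingEnd ℂ ((fourier 1 t : ℂ) ^ (m + 1))) := by
  induction n with
  | zero => simp [dirichletKernel]
  | succ n ih =>
    rw [Finset.sum_range_succ, ← add_assoc, ← ih, dirichletKernel, sum_Icc_neg_succ, fourier_neg,
      ← fourier_natCast, add_assoc]
    push_cast
    rfl

/-- Fejér positivity: expanding `|1 + z + ⋯ + z^{n-1}|²` on the unit circle gives `D_0 + ⋯ +
D_{n-1}`. It yields both the exact `L¹` norm and the quadratic decay away from `0`. -/
theorem dirichletSum_eq_normSq (n : ℕ) (t : Torus) :
    dirichletSum n t = ((‖∑ m ∈ Finset.range n, (fourier 1 t : ℂ) ^ m‖ ^ 2 : ℝ) : ℂ) := by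
  set z : ℂ := fourier 1 t with hz
  have hzz : z * starRingEnd ℂ z = 1 := by
    rw [Complex.mul_conj, Complex.normSq_eq_norm_sq, hz, norm_fourier_apply]; norm_num
  -- On the unit circle `z^n * conj (z^m) = z^(n-m)`, so the left side is the positive-frequency
  -- half of `D_n`: exactly the cross term gained when `n` increases by one.
  have key : ∀ n : ℕ, z ^ n * starRingEnd ℂ (∑ m ∈ Finset.range n, z ^ m) =
      ∑ m ∈ Finset.range n, z ^ (m + 1) := by
    intro n
    induction n with
    | zero => simp
    | succ n ih =>
      rw [Finset.sum_range_succ, map_add, mul_add, Finset.sum_range_succ', pow_succ', mul_assoc, ih,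
        Finset.mul_sum, map_pow, mul_assoc, ← mul_pow, hzz, one_pow, mul_one]
      congr 1
      · exact Finset.sum_congr rfl fun m _ => by ring
      · simp
  rw [Complex.ofReal_pow, ← Complex.mul_conj']
  induction n with
  | zero => simp [dirichletSum]
  | succ n ih =>
    have h3 : z ^ n * starRingEnd ℂ (z ^ n) = 1 := by rw [map_pow, ← mul_pow, hzz, one_pow]
    rw [dirichletSum, Finset.sum_range_succ, ← dirichletSum, ih, dirichletKernel_eq_add_conj,
      Finset.sum_range_succ, map_add, Finset.sum_add_distrib, ← map_sum, ← hz, ← key n, map_mul, Complex.conj_conj]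
    linear_combination -h3

theorem norm_dirichletSum (n : ℕ) (t : Torus) :
    ‖dirichletSum n t‖ = ‖∑ m ∈ Finset.range n, (fourier 1 t : ℂ) ^ m‖ ^ 2 := by
  rw [dirichletSum_eq_normSq, Complex.norm_real, Real.norm_of_nonneg (by positivity)]

theorem dirichletSum_eq_norm (n : ℕ) (t : Torus) :
    dirichletSum n t = (‖dirichletSum n t‖ : ℂ) := by
  rw [norm_dirichletSum, dirichletSum_eq_normSq]

theorem norm_dirichletSum_mul_chord_sq_le (n : ℕ) (t : Torus) :
    ‖dirichletSum n t‖ * chord t ^ 2 ≤ 4 := by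
  rw [norm_dirichletSum, ← mul_pow]
  calc _ ≤ (2 : ℝ) ^ 2 := pow_le_pow_left₀ (by unfold chord; positivity)
        (norm_geom_sum_mul_chord_le n t) 2
    _ = 4 := by norm_num

theorem continuous_dirichletKernel (N : ℕ) : Continuous (dirichletKernel N) := by
  unfold dirichletKernel; fun_prop

theorem continuous_dirichletSum (n : ℕ) : Continuous (dirichletSum n) := by
  unfold dirichletSum
  exact continuous_finsetSum _ fun k _ => continuous_dirichletKernel k

theorem integrable_torus_of_continuous {E : Type*} [NormedAddCommGroup E] {f : Torus → E}
    (hf : Continuous f) : Integrable f haarAddCircle :=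
  (ContinuousMap.mk f hf).continuous.integrable_of_hasCompactSupport
    (HasCompactSupport.of_compactSpace _)

theorem fourierCoeff_trigPoly (s : Finset ℤ) (c : ℤ → ℂ) (n : ℤ) :
    fourierCoeff (fun t : Torus => ∑ k ∈ s, c k * fourier k t) n = if n ∈ s then c n else 0 := by
  have h : (fun t : Torus => ∑ k ∈ s, c k * fourier k t) =
      ∑ k ∈ s, fun t : Torus => c k * (fourier k t : ℂ) := by
    ext t; simp only [Finset.sum_apply]
  rw [h, fourierCoeff.sum _ _ fun k _ => integrable_torus_of_continuous (by fun_prop)]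
  simp only [Finset.sum_apply]
  rw [Finset.sum_congr rfl fun k _ => fourierCoeff.const_mul _ _ _]
  simp only [fourierCoeff_fourier]
  simp [Pi.single_apply]

theorem norm_fourierCoeff_le (f : Torus → ℂ) (n : ℤ) :
    ‖fourierCoeff f n‖ ≤ ∫ t, ‖f t‖ ∂haarAddCircle := by
  refine (norm_integral_le_integral_norm _).trans_eq ?_
  refine integral_congr_ae (ae_of_all _ fun t => ?_)
  simp only [norm_smul, norm_fourier_apply, one_mul]

theorem fourierCoeff_dirichletKernel (N : ℕ) (n : ℤ) :
    fourierCoeff (dirichletKernel N) n = if n ∈ Finset.Icc (-(N : ℤ)) N then 1 else 0 := by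
  rw [← fourierCoeff_trigPoly _ (fun _ => 1)]
  simp only [one_mul]
  rfl

theorem integral_dirichletKernel (N : ℕ) : ∫ t, dirichletKernel N t ∂haarAddCircle = 1 := by
  have h := fourierCoeff_dirichletKernel N 0
  simpa [fourierCoeff] using h

/-- By positivity the `L¹` norm is just the integral, and each `D_k` has integral `1`. -/
theorem integral_norm_dirichletSum (n : ℕ) : ∫ t, ‖dirichletSum n t‖ ∂haarAddCircle = n := by
  have h : ∫ t, dirichletSum n t ∂haarAddCircle = n := by
    unfold dirichletSum
    rw [integral_finsetSum _ fun k _ => integrable_torus_of_continuous (continuous_dirichletKernel k)]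
    simp [integral_dirichletKernel]
  rw [integral_congr_ae (ae_of_all _ (dirichletSum_eq_norm n)), integral_complex_ofReal] at h
  exact_mod_cast h

/-! ### Logarithmic lower bound for the Lebesgue constants. -/

/-- The sawtooth function on the circle which is `x` for `0 < x ≤ 2π`. -/
noncomputable def sawtooth : Torus → ℂ := AddCircle.liftIoc (2 * Real.pi) 0 (fun x : ℝ => (x : ℂ))

theorem norm_sawtooth_le (t : Torus) : ‖sawtooth t‖ ≤ 2 * Real.pi := by
  have h := ((AddCircle.equivIoc (2 * Real.pi) 0) t).2
  change ‖(((AddCircle.equivIoc (2 * Real.pi) 0) t : ℝ) : ℂ)‖ ≤ _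
  rw [Complex.norm_real, Real.norm_of_nonneg h.1.le]
  simpa using h.2

theorem integrable_sawtooth : Integrable sawtooth haarAddCircle := by
  rw [← memLp_one_iff_integrable]
  apply MemLp.haarAddCircle
  unfold sawtooth
  apply MemLp.memLp_liftIoc
  rw [memLp_one_iff_integrable]
  exact (Complex.continuous_ofReal.integrableOn_Ioc)

theorem fourierCoeff_sawtooth {n : ℤ} (hn : n ≠ 0) :
    fourierCoeff sawtooth n = Complex.I / n := by
  rw [sawtooth, fourierCoeff_liftIoc_eq,
    fourierCoeffOn_of_hasDerivAt (f := fun x : ℝ => (x : ℂ)) (f' := fun _ => 1) _ hn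
      (fun x _ => Complex.ofRealCLM.hasDerivAt)
      (by simp)]
  -- The derivative `1` has no nonzero frequency, so only the jump of the sawtooth contributes to
  -- its coefficient.
  have hone : fourierCoeffOn (lt_add_of_pos_right 0 Torus.fact_two_pi_pos.out)
      (fun _ : ℝ => (1 : ℂ)) n = 0 := by
    rw [← fourierCoeff_liftIoc_eq]
    have h1 : AddCircle.liftIoc (2 * Real.pi) 0 (fun _ : ℝ => (1 : ℂ)) = dirichletKernel 0 := by
      ext t; rw [dirichletKernel_zero]; rfl
    rw [h1, fourierCoeff_dirichletKernel, if_neg]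
    simp only [Finset.mem_Icc]; omega
  rw [hone]
  have hpi : (Real.pi : ℂ) ≠ 0 := by exact_mod_cast Real.pi_ne_zero
  have hn' : (n : ℂ) ≠ 0 := by exact_mod_cast hn
  simp
  field_simp

/-- Duality with a bounded function. Multiplying by `e^{i(N+1)t}` moves the frequencies of `D_N` to
`1, …, 2N+1`, where pairing with the sawtooth produces terms `-i/(m+1)` without cancellation: a
harmonic sum. The factor `2π` is the sup bound of the sawtooth. -/
theorem log_le_integral_norm_dirichletKernel {N : ℕ} (hN : 1 ≤ N) :
    Real.log N ≤ 2 * Real.pi * ∫ t, ‖dirichletKernel N t‖ ∂haarAddCircle := by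
  have h1 : ∫ t, dirichletKernel N t * fourier ((N : ℤ) + 1) t * sawtooth t ∂haarAddCircle =
      -Complex.I * ((harmonic (2 * N + 1) : ℚ) : ℂ) := by
    have e : ∀ t : Torus, dirichletKernel N t * fourier ((N : ℤ) + 1) t * sawtooth t =
        ∑ m ∈ Finset.range (2 * N + 1), fourier (-(-((m : ℤ) + 1))) t • sawtooth t := by
      intro t
      rw [dirichletKernel, sum_Icc_neg_eq_sum_range, Finset.sum_mul, Finset.sum_mul]
      refine Finset.sum_congr rfl fun m _ => ?_
      rw [← fourier_add, smul_eq_mul]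
      congr 3
      ring
    simp_rw [e]
    rw [integral_finsetSum _ fun m _ => integrable_sawtooth.fourier_smul _]
    change ∑ m ∈ Finset.range (2 * N + 1), fourierCoeff sawtooth (-((m : ℤ) + 1)) = _
    rw [harmonic, Rat.cast_sum, Finset.mul_sum]
    refine Finset.sum_congr rfl fun m _ => ?_
    rw [fourierCoeff_sawtooth (by omega)]
    have : (m : ℂ) + 1 ≠ 0 := by exact_mod_cast Nat.succ_ne_zero m
    push_cast
    field_simp
  have h2 : (harmonic (2 * N + 1) : ℝ) ≤
      ∫ t, ‖dirichletKernel N t * fourier ((N : ℤ) + 1) t * sawtooth t‖ ∂haarAddCircle := by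
    refine le_trans ?_ (norm_integral_le_integral_norm _)
    rw [h1, norm_mul, norm_neg, Complex.norm_I, one_mul, Complex.norm_ratCast]
    exact le_abs_self _
  have h3 : ∫ t, ‖dirichletKernel N t * fourier ((N : ℤ) + 1) t * sawtooth t‖ ∂haarAddCircle ≤
      ∫ t, 2 * Real.pi * ‖dirichletKernel N t‖ ∂haarAddCircle := by
    refine integral_mono_of_nonneg (ae_of_all _ fun t => norm_nonneg _)
      ((integrable_torus_of_continuous (continuous_dirichletKernel N)).norm.const_mul _)
      (ae_of_all _ fun t => ?_)
    simp only [norm_mul, norm_fourier_apply, mul_one]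
    rw [mul_comm]
    exact mul_le_mul_of_nonneg_right (norm_sawtooth_le t) (norm_nonneg _)
  rw [integral_const_mul] at h3
  refine le_trans ?_ ((log_add_one_le_harmonic (2 * N + 1)).trans (h2.trans h3))
  apply Real.log_le_log
  · exact_mod_cast hN
  · exact_mod_cast (by omega : N ≤ 2 * N + 1 + 1)

/-! ### Null point and `L¹` convergence of series. -/

theorem haarAddCircle_singleton_zero : haarAddCircle ({0} : Set Torus) = 0 := by
  have h : volume ({0} : Set Torus) = 0 := by
    rw [← Metric.closedBall_zero, AddCircle.volume_closedBall]
    simp [Real.pi_pos.le]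
  rw [AddCircle.volume_eq_smul_haarAddCircle, Measure.smul_apply, smul_eq_mul, mul_eq_zero] at h
  exact h.resolve_left (by simp [Real.pi_pos])

theorem ae_torus_ne_zero : ∀ᵐ t : Torus ∂haarAddCircle, t ≠ 0 :=
  measure_eq_zero_iff_ae_notMem.1 haarAddCircle_singleton_zero

theorem lintegral_enorm_tsum_le {X E : Type*} [MeasurableSpace X] {μ : Measure X}
    [NormedAddCommGroup E] {f : ℕ → X → E} (hf : ∀ j, Integrable (f j) μ)
    (hs : Summable fun j => ∫ x, ‖f j x‖ ∂μ) :
    ∫⁻ x, ‖∑' j, f j x‖ₑ ∂μ ≤ ENNReal.ofReal (∑' j, ∫ x, ‖f j x‖ ∂μ) := by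
  rw [ENNReal.ofReal_tsum_of_nonneg (fun j => integral_nonneg fun _ => norm_nonneg _) hs]
  simp_rw [fun j => ofReal_integral_norm_eq_lintegral_enorm (hf j)]
  rw [← lintegral_tsum fun j => (hf j).1.enorm]
  exact lintegral_mono fun x => enorm_tsum_le_tsum_enorm

/-- `E` need not be complete, so pointwise summability is a separate assumption. -/
theorem integrable_tsum_of_summable_integral_norm {X E : Type*} [MeasurableSpace X]
    {μ : Measure X} [NormedAddCommGroup E] {f : ℕ → X → E} (hf : ∀ j, Integrable (f j) μ)
    (hs : Summable fun j => ∫ x, ‖f j x‖ ∂μ) (hp : ∀ᵐ x ∂μ, Summable fun j => f j x) :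
    Integrable (fun x => ∑' j, f j x) μ := by
  refine ⟨aestronglyMeasurable_of_tendsto_ae atTop
    (f := fun n x => ∑ j ∈ Finset.range n, f j x)
    (fun n => (integrable_finsetSum _ fun j _ => hf j).1) ?_,
    (lintegral_enorm_tsum_le hf hs).trans_lt ENNReal.ofReal_lt_top⟩
  filter_upwards [hp] with x hx using hx.hasSum.tendsto_sum_nat

theorem integral_norm_tsum_le {X E : Type*} [MeasurableSpace X] {μ : Measure X}
    [NormedAddCommGroup E] {f : ℕ → X → E} (hf : ∀ j, Integrable (f j) μ)
    (hs : Summable fun j => ∫ x, ‖f j x‖ ∂μ) (hp : ∀ᵐ x ∂μ, Summable fun j => f j x) :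
    ∫ x, ‖∑' j, f j x‖ ∂μ ≤ ∑' j, ∫ x, ‖f j x‖ ∂μ := by
  rw [integral_norm_eq_lintegral_enorm (integrable_tsum_of_summable_integral_norm hf hs hp).1]
  exact ENNReal.toReal_le_of_le_ofReal
    (tsum_nonneg fun j => integral_nonneg fun _ => norm_nonneg _) (lintegral_enorm_tsum_le hf hs)

theorem tendsto_integral_norm_tsum_sub_sum {X E : Type*} [MeasurableSpace X] {μ : Measure X}
    [NormedAddCommGroup E] {f : ℕ → X → E} (hf : ∀ j, Integrable (f j) μ)
    (hs : Summable fun j => ∫ x, ‖f j x‖ ∂μ) (hp : ∀ᵐ x ∂μ, Summable fun j => f j x) :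
    Tendsto (fun N => ∫ x, ‖∑' j, f j x - ∑ j ∈ Finset.range N, f j x‖ ∂μ) atTop (𝓝 0) := by
  refine squeeze_zero (fun N => integral_nonneg fun _ => norm_nonneg _) (fun N => ?_)
    (tendsto_sum_nat_add fun j => ∫ x, ‖f j x‖ ∂μ)
  have e : ∫ x, ‖∑' j, f j x - ∑ j ∈ Finset.range N, f j x‖ ∂μ =
      ∫ x, ‖∑' j, f (j + N) x‖ ∂μ := by
    refine integral_congr_ae ?_
    filter_upwards [hp] with x hx
    rw [← hx.sum_add_tsum_nat_add N, add_sub_cancel_left]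
  rw [e]
  exact integral_norm_tsum_le (fun j => hf (j + N))
    ((summable_nat_add_iff N).2 hs)
    (hp.mono fun x hx => (summable_nat_add_iff N).2 hx)

/-! ### Convex sequences tending to zero. -/

section ConvexSequence

variable {b : ℕ → ℝ}

theorem antitone_sub_succ_of_convex (hb : ∀ n, 0 ≤ b n + b (n + 2) - 2 * b (n + 1)) :
    Antitone fun n => b n - b (n + 1) :=
  antitone_nat_of_succ_le fun n => by linarith [hb n]

theorem tendsto_sub_succ_zero (h0 : Tendsto b atTop (𝓝 0)) :
    Tendsto (fun n => b n - b (n + 1)) atTop (𝓝 0) := by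
  simpa using h0.sub (h0.comp (tendsto_add_atTop_nat 1))

theorem sub_succ_nonneg_of_convex (hb : ∀ n, 0 ≤ b n + b (n + 2) - 2 * b (n + 1))
    (h0 : Tendsto b atTop (𝓝 0)) (n : ℕ) : 0 ≤ b n - b (n + 1) :=
  (antitone_sub_succ_of_convex hb).le_of_tendsto (tendsto_sub_succ_zero h0) n

theorem sum_succ_mul_secondDiff (b : ℕ → ℝ) (n : ℕ) :
    ∑ j ∈ Finset.range n, ((j : ℝ) + 1) * (b j + b (j + 2) - 2 * b (j + 1)) =
      b 0 - b n - n * (b n - b (n + 1)) := by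
  induction n with
  | zero => simp
  | succ n ih => rw [Finset.sum_range_succ, ih]; push_cast; ring

theorem summable_succ_mul_secondDiff (hb : ∀ n, 0 ≤ b n + b (n + 2) - 2 * b (n + 1))
    (hpos : ∀ n, 0 ≤ b n) (h0 : Tendsto b atTop (𝓝 0)) :
    Summable fun j : ℕ => ((j : ℝ) + 1) * (b j + b (j + 2) - 2 * b (j + 1)) := by
  refine summable_of_sum_range_le (c := b 0) (fun j => mul_nonneg (by positivity) (hb j))
    fun n => ?_
  rw [sum_succ_mul_secondDiff]
  have := mul_nonneg n.cast_nonneg (sub_succ_nonneg_of_convex hb h0 n)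
  linarith [hpos n]

/-- `n (Δb_n - Δb_{n+m})`, with `Δb_n = b_n - b_{n+1}`, is `n` times a sum of second differences of
index at least `n`, hence at most a tail of the convergent series with weights `j + 1`. Letting `m →
∞` removes `Δb_{n+m}`. -/
theorem tendsto_nat_mul_sub_succ (hb : ∀ n, 0 ≤ b n + b (n + 2) - 2 * b (n + 1))
    (hpos : ∀ n, 0 ≤ b n) (h0 : Tendsto b atTop (𝓝 0)) :
    Tendsto (fun n : ℕ => n * (b n - b (n + 1))) atTop (𝓝 0) := by
  have hs := summable_succ_mul_secondDiff hb hpos h0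
  set c : ℕ → ℝ := fun j => ((j : ℝ) + 1) * (b j + b (j + 2) - 2 * b (j + 1)) with hc
  have hc0 : ∀ j, 0 ≤ c j := fun j => mul_nonneg (by positivity) (hb j)
  refine squeeze_zero
    (fun n => mul_nonneg n.cast_nonneg (sub_succ_nonneg_of_convex hb h0 n)) (fun n => ?_)
    (tendsto_sum_nat_add c)
  have hn := (summable_nat_add_iff n).2 hs
  have step : ∀ m, (n : ℝ) * (b n - b (n + 1)) - n * (b (m + n) - b (m + n + 1)) ≤
      ∑' j, c (j + n) := by
    intro m
    refine le_trans ?_ (hn.sum_le_tsum (Finset.range m) fun j _ => hc0 _)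
    induction m with
    | zero => simp
    | succ m ih =>
      rw [Finset.sum_range_succ, hc]
      have h1 : (0 : ℝ) ≤ (m + 1) * (b (m + n) + b (m + n + 2) - 2 * b (m + n + 1)) :=
        mul_nonneg (by positivity) (hb _)
      have e : m + 1 + n = m + n + 1 := by ring
      rw [e]
      push_cast
      rw [hc] at ih
      push_cast at ih
      linarith
  have hlim : Tendsto (fun m => (n : ℝ) * (b n - b (n + 1)) - n * (b (m + n) - b (m + n + 1)))
      atTop (𝓝 ((n : ℝ) * (b n - b (n + 1)) - n * 0)) :=
    tendsto_const_nhds.sub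
      (((tendsto_sub_succ_zero h0).comp (tendsto_add_atTop_nat n)).const_mul _)
  simpa using le_of_tendsto' hlim step

end ConvexSequence

/-! ### The Fejér series and its Fourier partial sums. -/

theorem fejerTerm_eq (a : ℤ → ℝ) (j : ℕ) (t : Torus) :
    fejerTerm a j t = ((a j + a (j + 2) - 2 * a (j + 1) : ℝ) : ℂ) * dirichletSum (j + 1) t := by
  have h : (j : ℂ) + 1 ≠ 0 := by exact_mod_cast Nat.succ_ne_zero j
  rw [fejerTerm, fejerKernel, dirichletSum]
  push_cast
  field_simp

theorem continuous_fejerTerm (a : ℤ → ℝ) (j : ℕ) : Continuous (fejerTerm a j) := by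
  rw [funext (fejerTerm_eq a j)]
  exact continuous_const.mul (continuous_dirichletSum _)

/-- Summation by parts, twice. -/
theorem sum_fejerTerm_add {a : ℤ → ℝ} (ha_even : ∀ n : ℤ, a (-n) = a n) (N : ℕ) (t : Torus) :
    ∑ j ∈ Finset.range N, fejerTerm a j t + ((a N - a (N + 1) : ℝ) : ℂ) * dirichletSum N t
        + (a N : ℂ) * dirichletKernel N t =
      ∑ k ∈ Finset.Icc (-(N : ℤ)) N, (a k : ℂ) * fourier k t := by
  induction N with
  | zero => simp [dirichletSum, dirichletKernel_zero]
  | succ N ih =>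
    have hD : dirichletKernel (N + 1) t =
        dirichletKernel N t + fourier ((N : ℤ) + 1) t + fourier (-((N : ℤ) + 1)) t := by
      simp only [dirichletKernel, sum_Icc_neg_succ]
    have hS : dirichletSum (N + 1) t = dirichletSum N t + dirichletKernel N t :=
      Finset.sum_range_succ _ _
    have e : (N : ℤ) + 1 + 1 = N + 2 := by ring
    rw [sum_Icc_neg_succ, ← ih, Finset.sum_range_succ, fejerTerm_eq, ha_even, hD, hS]
    push_cast
    rw [e]
    ring

section Main

variable {a : ℤ → ℝ}

theorem summable_norm_fejerTerm
    (ha_pos : ∀ n : ℤ, 0 < a n) (ha_convex : ∀ n : ℕ, 0 ≤ a n + a (n + 2) - 2 * a (n + 1))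
    (h0 : Tendsto (fun n : ℕ => a n) atTop (𝓝 0)) {t : Torus} (ht : t ≠ 0) :
    Summable fun j : ℕ => ‖fejerTerm a j t‖ := by
  have hs := summable_succ_mul_secondDiff (b := fun n : ℕ => a n)
    (by exact_mod_cast ha_convex) (fun n => (ha_pos n).le) h0
  refine Summable.of_nonneg_of_le (fun j => norm_nonneg _) (fun j => ?_)
    (hs.mul_right (4 / chord t ^ 2))
  have hc := chord_pos ht
  rw [fejerTerm_eq, norm_mul, Complex.norm_real, Real.norm_of_nonneg (ha_convex j)]
  push_cast
  rw [mul_assoc]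
  have h1 : ‖dirichletSum (j + 1) t‖ ≤ 4 / chord t ^ 2 :=
    (le_div_iff₀ (by positivity)).2 (norm_dirichletSum_mul_chord_sq_le _ _)
  have h2 := ha_convex j
  calc _ ≤ (a j + a (j + 2) - 2 * a (j + 1)) * (4 / chord t ^ 2) := by gcongr
    _ ≤ ((j : ℝ) + 1) * ((a j + a (j + 2) - 2 * a (j + 1)) * (4 / chord t ^ 2)) :=
        le_mul_of_one_le_left (by positivity) (by linarith [(j.cast_nonneg : (0 : ℝ) ≤ j)])

theorem integral_norm_fejerTerm
    (ha_convex : ∀ n : ℕ, 0 ≤ a n + a (n + 2) - 2 * a (n + 1)) (j : ℕ) :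
    ∫ t, ‖fejerTerm a j t‖ ∂haarAddCircle =
      ((j : ℝ) + 1) * (a j + a (j + 2) - 2 * a (j + 1)) := by
  simp_rw [fejerTerm_eq, norm_mul, Complex.norm_real, Real.norm_of_nonneg (ha_convex j)]
  rw [integral_const_mul, integral_norm_dirichletSum]
  push_cast
  ring

theorem integrable_fejerSum
    (ha_pos : ∀ n : ℤ, 0 < a n) (ha_convex : ∀ n : ℕ, 0 ≤ a n + a (n + 2) - 2 * a (n + 1))
    (h0 : Tendsto (fun n : ℕ => a n) atTop (𝓝 0)) :
    Integrable (fejerSum a) haarAddCircle ∧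
    Tendsto (fun N => ∫ t, ‖fejerSum a t - ∑ j ∈ Finset.range N, fejerTerm a j t‖ ∂haarAddCircle)
      atTop (𝓝 0) := by
  have hf : ∀ j, Integrable (fejerTerm a j) haarAddCircle := fun j =>
    integrable_torus_of_continuous (continuous_fejerTerm a j)
  have hs : Summable fun j => ∫ t, ‖fejerTerm a j t‖ ∂haarAddCircle := by
    simp_rw [integral_norm_fejerTerm ha_convex]
    exact_mod_cast summable_succ_mul_secondDiff (b := fun n : ℕ => a n)
      (by exact_mod_cast ha_convex) (fun n => (ha_pos n).le) h0
  have hp : ∀ᵐ t ∂haarAddCircle, Summable fun j => fejerTerm a j t :=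
    ae_torus_ne_zero.mono fun t ht => (summable_norm_fejerTerm ha_pos ha_convex h0 ht).of_norm
  exact ⟨integrable_tsum_of_summable_integral_norm hf hs hp,
    tendsto_integral_norm_tsum_sub_sum hf hs hp⟩

/-- After summation by parts, what remains is the tail of the Fejér series and `(a_N - a_{N+1}) (D_0
+ ⋯ + D_{N-1})`, of norm `N (a_N - a_{N+1})`. -/
theorem tendsto_integral_norm_fejerSum_sub_add
    (ha_even : ∀ n : ℤ, a (-n) = a n)
    (ha_pos : ∀ n : ℤ, 0 < a n) (ha_convex : ∀ n : ℕ, 0 ≤ a n + a (n + 2) - 2 * a (n + 1))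
    (h0 : Tendsto (fun n : ℕ => a n) atTop (𝓝 0)) :
    Tendsto (fun N : ℕ => ∫ t, ‖fejerSum a t
      - ∑ k ∈ Finset.Icc (-(N : ℤ)) N, (a k : ℂ) * fourier k t
      + (a N : ℂ) * dirichletKernel N t‖ ∂haarAddCircle) atTop (𝓝 0) := by
  obtain ⟨hi, hlim⟩ := integrable_fejerSum ha_pos ha_convex h0
  have hconv : ∀ n : ℕ, 0 ≤ a n + a ((n + 2 : ℕ) : ℤ) - 2 * a ((n + 1 : ℕ) : ℤ) := by
    exact_mod_cast ha_convex
  have hΔ := tendsto_nat_mul_sub_succ (b := fun n : ℕ => a n) hconv (fun n => (ha_pos n).le) h0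
  have hΔ0 := sub_succ_nonneg_of_convex (b := fun n : ℕ => a n) hconv h0
  push_cast at hΔ hΔ0
  have hsum := hlim.add hΔ
  rw [add_zero] at hsum
  refine squeeze_zero (fun N => integral_nonneg fun _ => norm_nonneg _) (fun N => ?_) hsum
  have hP : Integrable (fun t => fejerSum a t - ∑ j ∈ Finset.range N, fejerTerm a j t)
      haarAddCircle := hi.sub (integrable_finsetSum _ fun j _ =>
    integrable_torus_of_continuous (continuous_fejerTerm a j))
  have hS := integrable_torus_of_continuous (continuous_dirichletSum N)
  have e : (N : ℝ) * (a N - a (N + 1)) =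
      ∫ t, (a N - a (N + 1)) * ‖dirichletSum N t‖ ∂haarAddCircle := by
    rw [integral_const_mul, integral_norm_dirichletSum, mul_comm]
  rw [e, ← integral_add hP.norm (hS.norm.const_mul _)]
  refine integral_mono_of_nonneg (ae_of_all _ fun t => norm_nonneg _)
    (hP.norm.add (hS.norm.const_mul _)) (ae_of_all _ fun t => ?_)
  simp only [← sum_fejerTerm_add ha_even]
  have h1 : ‖((a N - a (N + 1) : ℝ) : ℂ) * dirichletSum N t‖ =
      (a N - a (N + 1)) * ‖dirichletSum N t‖ := by
    rw [norm_mul, Complex.norm_real, Real.norm_of_nonneg (hΔ0 N)]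
  rw [← h1]
  refine le_of_eq_of_le (congrArg norm ?_) (norm_sub_le _ _)
  ring

/-- For `N ≥ |n|` the `n`-th coefficient of the `L¹`-null remainder is `f̂(n) - a_n + a_N`, and `a_N
→ 0`. -/
theorem fourierCoeff_fejerSum
    (ha_even : ∀ n : ℤ, a (-n) = a n)
    (ha_pos : ∀ n : ℤ, 0 < a n) (ha_convex : ∀ n : ℕ, 0 ≤ a n + a (n + 2) - 2 * a (n + 1))
    (h0 : Tendsto (fun n : ℕ => a n) atTop (𝓝 0)) (n : ℤ) :
    fourierCoeff (fejerSum a) n = a n := by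
  have hi := (integrable_fejerSum ha_pos ha_convex h0).1
  have hlim := tendsto_integral_norm_fejerSum_sub_add ha_even ha_pos ha_convex h0
  have hcoeff : ∀ N : ℕ, n ∈ Finset.Icc (-(N : ℤ)) N →
      fourierCoeff (fun t => fejerSum a t
        - ∑ k ∈ Finset.Icc (-(N : ℤ)) N, (a k : ℂ) * fourier k t
        + (a N : ℂ) * dirichletKernel N t) n = fourierCoeff (fejerSum a) n - a n + a N := by
    intro N hn
    have hT : Integrable (fun t : Torus => ∑ k ∈ Finset.Icc (-(N : ℤ)) N,
        (-a k : ℂ) * fourier k t) haarAddCircle :=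
      integrable_torus_of_continuous (by fun_prop)
    have hD : Integrable (fun t => (a N : ℂ) * dirichletKernel N t) haarAddCircle :=
      (integrable_torus_of_continuous (continuous_dirichletKernel N)).const_mul _
    have e : (fun t => fejerSum a t
        - ∑ k ∈ Finset.Icc (-(N : ℤ)) N, (a k : ℂ) * fourier k t
        + (a N : ℂ) * dirichletKernel N t) =
        fejerSum a + (fun t : Torus => ∑ k ∈ Finset.Icc (-(N : ℤ)) N, (-a k : ℂ) * fourier k t)
        + fun t => (a N : ℂ) * dirichletKernel N t := by
      ext t
      simp only [Pi.add_apply, neg_mul, Finset.sum_neg_distrib, sub_eq_add_neg]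
    rw [e, fourierCoeff.add (hi.add hT) hD, fourierCoeff.add hi hT]
    simp only [Pi.add_apply]
    rw [fourierCoeff_trigPoly _ (fun k => (-a k : ℂ)), fourierCoeff.const_mul,
      fourierCoeff_dirichletKernel, if_pos hn, if_pos hn, mul_one, sub_eq_add_neg]
  have hmem : ∀ᶠ N : ℕ in atTop, n ∈ Finset.Icc (-(N : ℤ)) N := by
    filter_upwards [eventually_ge_atTop n.natAbs] with N hN
    simp only [Finset.mem_Icc]; omega
  have h1 : Tendsto (fun N : ℕ => fourierCoeff (fejerSum a) n - a n + a N) atTop (𝓝 0) := by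
    refine squeeze_zero_norm' ?_ hlim
    filter_upwards [hmem] with N hN
    rw [← hcoeff N hN]
    exact norm_fourierCoeff_le _ n
  have h2 : Tendsto (fun N : ℕ => fourierCoeff (fejerSum a) n - a n + ((a N : ℝ) : ℂ)) atTop
      (𝓝 (fourierCoeff (fejerSum a) n - a n + ((0 : ℝ) : ℂ))) :=
    tendsto_const_nhds.add ((Complex.continuous_ofReal.tendsto 0).comp h0)
  have h3 := tendsto_nhds_unique h1 h2
  rw [Complex.ofReal_zero, add_zero] at h3
  exact sub_eq_zero.1 h3.symm

/-- The reverse triangle inequality bounds the difference by the remainder integrated over the whole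
torus, uniformly in `E`. -/
theorem tendsto_setIntegral_sub
    (ha_even : ∀ n : ℤ, a (-n) = a n)
    (ha_pos : ∀ n : ℤ, 0 < a n) (ha_convex : ∀ n : ℕ, 0 ≤ a n + a (n + 2) - 2 * a (n + 1))
    (h0 : Tendsto (fun n : ℕ => a n) atTop (𝓝 0)) (E : Set Torus) :
    Tendsto (fun N : ℕ => ∫ t in E, a N * ‖dirichletKernel N t‖ ∂haarAddCircle
      - ∫ t in E, ‖fejerSum a t - fourierPartialSum (fejerSum a) N t‖ ∂haarAddCircle)
      atTop (𝓝 0) := by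
  have hi := (integrable_fejerSum ha_pos ha_convex h0).1
  refine squeeze_zero_norm (fun N => ?_)
    (tendsto_integral_norm_fejerSum_sub_add ha_even ha_pos ha_convex h0)
  have hS : ∀ t, fourierPartialSum (fejerSum a) N t =
      ∑ k ∈ Finset.Icc (-(N : ℤ)) N, (a k : ℂ) * fourier k t := fun t =>
    Finset.sum_congr rfl fun k _ => by
      rw [fourierCoeff_fejerSum ha_even ha_pos ha_convex h0]
  simp_rw [hS]
  have hF : Integrable (fun t => fejerSum a t - ∑ k ∈ Finset.Icc (-(N : ℤ)) N,
      (a k : ℂ) * fourier k t) haarAddCircle :=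
    hi.sub (integrable_torus_of_continuous (by fun_prop))
  have hD := integrable_torus_of_continuous (continuous_dirichletKernel N)
  have hH := hF.add (hD.const_mul (a N : ℂ))
  rw [← integral_sub (hD.norm.const_mul _).integrableOn hF.norm.integrableOn]
  refine (norm_integral_le_integral_norm _).trans ?_
  refine le_trans ?_ (setIntegral_le_integral (s := E) hH.norm (ae_of_all _ fun t => norm_nonneg _))
  refine integral_mono_of_nonneg (ae_of_all _ fun t => norm_nonneg _) hH.norm.integrableOn
    (ae_of_all _ fun t => ?_)
  have h1 : a N * ‖dirichletKernel N t‖ = ‖(a N : ℂ) * dirichletKernel N t‖ := by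
    rw [norm_mul, Complex.norm_real, Real.norm_of_nonneg (ha_pos N).le]
  have h := abs_norm_sub_norm_le ((a N : ℂ) * dirichletKernel N t)
    (-(fejerSum a t - ∑ k ∈ Finset.Icc (-(N : ℤ)) N, (a k : ℂ) * fourier k t))
  rw [norm_neg, sub_neg_eq_add, add_comm (_ * _)] at h
  simpa only [h1, Real.norm_eq_abs] using h

end Main

/-! ### Concentration at `t = 0` and conclusion. -/

theorem tendsto_zero_of_mul_log_isBigO {b : ℕ → ℝ}
    (h : (fun n : ℕ => b n * Real.log n) =O[atTop] (fun _ : ℕ => (1 : ℝ))) :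
    Tendsto b atTop (𝓝 0) := by
  have hlog : Tendsto (fun n : ℕ => Real.log n) atTop atTop :=
    Real.tendsto_log_atTop.comp tendsto_natCast_atTop_atTop
  have h1 := h.mul_isLittleO
    ((isLittleO_one_iff ℝ).2 (tendsto_inv_atTop_zero.comp hlog))
  simp only [one_mul] at h1
  refine ((isLittleO_one_iff ℝ).1 h1).congr' ?_
  filter_upwards [hlog.eventually (eventually_gt_atTop 0)] with n hn
  simp only [Function.comp]
  field_simp

/-- The sets shrink to the null set `{0}`, so absolute continuity of the integral applies. -/
theorem tendsto_setIntegral_chord_lt {g : Torus → ℝ} (hg : Integrable g haarAddCircle) :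
    Tendsto (fun δ => ∫ t in {t | chord t < δ}, g t ∂haarAddCircle) (𝓝[>] 0) (𝓝 0) := by
  refine hg.tendsto_setIntegral_nhds_zero ?_
  have h := tendsto_measure_biInter_gt (μ := (haarAddCircle : Measure Torus))
    (s := fun δ : ℝ => {t | chord t < δ}) (a := 0)
    (fun δ _ => (measurableSet_lt continuous_chord.measurable measurable_const).nullMeasurableSet)
    (fun i j _ hij t ht => lt_of_lt_of_le ht hij) ⟨1, one_pos, measure_ne_top _ _⟩
  have e : ⋂ δ > (0 : ℝ), {t : Torus | chord t < δ} = {0} := by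
    ext t
    simp only [Set.mem_iInter, Set.mem_ofPred_eq, Set.mem_singleton_iff]
    constructor
    · intro ht
      by_contra hne
      exact lt_irrefl _ (ht _ (chord_pos hne))
    · rintro rfl δ hδ
      rwa [chord_eq_zero_iff.2 rfl]
  rw [e, haarAddCircle_singleton_zero] at h
  exact h

theorem setIntegral_norm_dirichletKernel_le (N : ℕ) {δ : ℝ} (hδ : 0 < δ) :
    ∫ t in {t | δ ≤ chord t}, ‖dirichletKernel N t‖ ∂haarAddCircle ≤ 2 / δ := by
  have hm : MeasurableSet {t | δ ≤ chord t} :=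
    measurableSet_le measurable_const continuous_chord.measurable
  calc ∫ t in {t | δ ≤ chord t}, ‖dirichletKernel N t‖ ∂haarAddCircle
      ≤ ∫ t in {t | δ ≤ chord t}, 2 / δ ∂haarAddCircle := by
        refine setIntegral_mono_on
          (integrable_torus_of_continuous (continuous_dirichletKernel N)).norm.integrableOn
          (integrable_const _).integrableOn hm fun t ht => ?_
        rw [le_div_iff₀ hδ]
        exact (mul_le_mul_of_nonneg_left ht (norm_nonneg _)).trans
          (norm_dirichletKernel_mul_chord_le N t)
    _ ≤ ∫ t, 2 / δ ∂haarAddCircle :=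
        setIntegral_le_integral (integrable_const _) (ae_of_all _ fun t => by positivity)
    _ = 2 / δ := by simp

theorem mainTheorem6 (a : ℤ → ℝ)
    (ha_even : ∀ n : ℤ, a (-n) = a n)
    (ha_pos : ∀ n : ℤ, 0 < a n)
    (ha_convex : ∀ n : ℕ, 0 ≤ a n + a (n + 2) - 2 * a (n + 1))
    (ha_bigO : (fun n : ℕ => a n * Real.log n) =O[atTop] (fun _ : ℕ => (1 : ℝ)))
    (ha_not_littleO : ¬ (fun n : ℕ => a n * Real.log n) =o[atTop] (fun _ : ℕ => (1 : ℝ))) :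
    (∀ t : Torus, t ≠ 0 → Summable (fun j : ℕ => fejerTerm a j t)) ∧
    Integrable (fejerSum a) AddCircle.haarAddCircle ∧
    ∃ E : Set Torus, MeasurableSet E ∧
      ¬ ∃ L : ℝ, Tendsto
        (fun N : ℕ => ∫ t in E, ‖fejerSum a t - fourierPartialSum (fejerSum a) N t‖
          ∂AddCircle.haarAddCircle)
        atTop (𝓝 L) := by
  have h0 : Tendsto (fun n : ℕ => a n) atTop (𝓝 0) := tendsto_zero_of_mul_log_isBigO ha_bigO
  refine ⟨fun t ht => (summable_norm_fejerTerm ha_pos ha_convex h0 ht).of_norm,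
    (integrable_fejerSum ha_pos ha_convex h0).1, ?_⟩
  have hD : ∀ N : ℕ, Integrable (fun t => a N * ‖dirichletKernel N t‖) haarAddCircle := fun N =>
    (integrable_torus_of_continuous (continuous_dirichletKernel N)).norm.const_mul _
  obtain ⟨ε, hε, hfreq⟩ : ∃ ε > 0, ∃ᶠ n : ℕ in atTop, ε ≤ a n * Real.log n := by
    rw [isLittleO_one_iff, Metric.tendsto_nhds] at ha_not_littleO
    push Not at ha_not_littleO
    obtain ⟨ε, hε, h⟩ := ha_not_littleO
    refine ⟨ε, hε, h.mono fun n hn => ?_⟩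
    rwa [Real.dist_eq, sub_zero,
      abs_of_nonneg (mul_nonneg (ha_pos n).le (Real.log_natCast_nonneg n))] at hn
  obtain ⟨E, hE, hdiv⟩ := exists_not_tendsto_setIntegral (μ := haarAddCircle)
    continuous_chord.measurable
    (g := fun (N : ℕ) t => a N * ‖dirichletKernel N t‖)
    (fun N t => mul_nonneg (ha_pos N).le (norm_nonneg _)) hD
    (c := ε / (2 * Real.pi)) (by positivity)
    ((hfreq.and_eventually (eventually_ge_atTop 1)).mono fun N hN => by
      rw [div_le_iff₀ (by positivity), integral_const_mul]
      calc ε ≤ a N * Real.log N := hN.1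
        _ ≤ a N * (2 * Real.pi * ∫ t, ‖dirichletKernel N t‖ ∂haarAddCircle) :=
          mul_le_mul_of_nonneg_left (log_le_integral_norm_dirichletKernel hN.2) (ha_pos N).le
        _ = _ := by ring)
    (fun δ hδ => by
      refine squeeze_zero (g := fun N : ℕ => a N * (2 / δ))
        (fun N => integral_nonneg fun t => mul_nonneg (ha_pos N).le (norm_nonneg _))
        (fun N => ?_) (by simpa using h0.mul_const (2 / δ))
      rw [integral_const_mul]
      exact mul_le_mul_of_nonneg_left (setIntegral_norm_dirichletKernel_le N hδ) (ha_pos N).le)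
    (fun N => tendsto_setIntegral_chord_lt (hD N))
  -- A limit for `|f - S_N|` on `E` would, after adding the `o(1)` difference, be a limit for `a_N
  -- |D_N|`.
  refine ⟨E, hE, fun ⟨L, hL⟩ => hdiv ⟨L, ?_⟩⟩
  simpa using (tendsto_setIntegral_sub ha_even ha_pos ha_convex h0 E).add hL
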